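/- Let $X$ be a finite linearly ordered set and let $P$ be the set of all non-associative words on $X$ (finite parenthesized words), including the empty word $1$, which is neutral for juxtaposition. Write $|v|$ for the number of letters of $v$, and $v_1v_2\cdots v_n$ for the left-normed product $(\dots((v_1v_2)v_3)\dots)v_n$. *Reduced words and $\pi$.* Let $W\subset P$ consist of $1$ and all nonempty words having no subword of the form $uu$ or $(uv)v$ with $u,v$ nonempty. Define $\pi:P\to W$ by $\pi(1)=1$; $\pi(x)=x$ for $x\in X$; for nonempty $u,v\in W$, $\pi(uv)=1$ if $u=v$, $\pi(uv)=a$ if $u=av$ with $a\neq 1$, and $\pi(uv)=uv$ if $uv\in W$; and $\pi(uv)=\pi(\pi(u)\pi(v))$ if $u\notin W$ or $v\notin W$. *Order.* Order nonempty words by: letters are ordered as in $X$; $u<v$ if $|u|<|v|$; and if $|u|=|v|\ge 2$, $u=u_1u_2$, $v=v_1v_2$ with nonempty factors, then $u<v$ if and only if $u_2<v_2$, or $u_2=v_2$ and $u_1<v_1$. *The set $R(X)$.* Every word $y$ with $|y|\ge 2$ has a unique decomposition $y=y_1y_2\cdots y_{m-1}y_m'$ with $m\ge2$, $|y_1|=1$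 and all factors nonempty; put $y^t=y_m'y_{m-1}\cdots y_1$, and put $y^t=y$ if $|y|=1$. Let $y^{tt}=(y^t)^t$ and $y_0=\min\{y^t,y^{tt}\}$. Let $$D=\{y_0 \mid y\in W\setminus\{1\},\ y_0\in W,\ y_0^t\in W,\ y_0^t\ne y_0\}.$$ Let $R_1=X$, and for $n>1$ let $R_n=R_{n-1}\cup\{y\in D \mid |y|\le n,\ y=u_1u_2\cdots u_k \text{ for some } k\ge 1 \text{ and } u_1,\dots,u_k\in R_{n-1}\}$. Put $R(X)=\bigcup_{n\ge1}R_n$ and $$B(X)=\{1\}\cup\{y\in W \mid y=y_1y_2\cdots y_n \text{ for some } n\ge1 \text{ and } y_1,\dots,y_n\in R(X)\}.$$ **Theorem.** For every $g\in B(X)\setminus\{1\}$ there is exactly one finite sequence $g_1,\dots,g_m$ ($m\ge1$) of elements of $R(X)$ such that $g_i\neq g_{i+1}$ for $i=1,\dots,m-1$ and $$g=\pi(g_1g_2\cdots g_{m-1}\,g_m\,g_{m-1}\cdots g_2g_1).$$ -/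

import Mathlib

namespace FreeBol

variable {X : Type*}

/-- The set `P(X)` of all non-associative words on `X`. The nonempty words are the elements of the
free magma; the empty word is the element `1`, which is neutral for the juxtaposition `*`. -/
abbrev Word (X : Type*) : Type _ := WithOne (FreeMagma X)

/-- The left-normed product `v₁ v₂ … vₙ = (…((v₁ v₂) v₃)…) vₙ`. -/
def leftProd (l : List (FreeMagma X)) : Word X :=
  l.foldl (fun p v => p * (v : Word X)) 1

/-- The left-normed product `g₁ g₂ … gₘ gₘ₋₁ … g₂ g₁` attached to the list `g₁, …, gₘ`. -/
def symProd (l : List (FreeMagma X)) : Word X :=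
  leftProd (l ++ l.reverse.tail)

/-- The set of (nonempty) subwords of a nonempty word. -/
def sub : FreeMagma X → Set (FreeMagma X)
  | .of x => {.of x}
  | .mul u v => {u * v} ∪ sub u ∪ sub v

/-- The set `C(X)` of all words `u u` and `(u v) v`, with `u`, `v` nonempty. -/
def C (X : Type*) : Set (FreeMagma X) :=
  {w | (∃ u, w = u * u) ∨ ∃ u v, w = (u * v) * v}

/-- The nonempty elements of `W(X)`: the words none of whose subwords lies in `C(X)`. -/
def W (X : Type*) : Set (FreeMagma X) :=
  {w | sub w ∩ C X = ∅}

open scoped Classical in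
/-- The reduced product of nonempty words `u` and `v`: the empty word if `u = v`, the word `a` if
`u = a v`, and the word `u v` otherwise. -/
noncomputable def redMul : FreeMagma X → FreeMagma X → Word X
  | .of x, v => if .of x = v then 1 else ((.of x * v : FreeMagma X) : Word X)
  | .mul a b, v =>
      if a * b = v then 1 else if b = v then (a : Word X) else ((a * b * v : FreeMagma X) : Word X)

/-- The reduced product of two words, either of which may be empty. -/
noncomputable def redMulWord (p q : Word X) : Word X :=
  WithOne.recOneCoe q (fun u => WithOne.recOneCoe (u : Word X) (fun v => redMul u v) q) p

/-- The map `π` on nonempty words. -/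
noncomputable def redNonempty : FreeMagma X → Word X
  | .of x => (FreeMagma.of x : Word X)
  | .mul u v => redMulWord (redNonempty u) (redNonempty v)

/-- The map `π`, from words to words (with values in `W(X) ∪ {1}`). The facts `red_of`, `red_self`,
`red_cancel`, `red_mul_of_mem_W` and `red_mul` below are the rules that define it by induction on
the length; `red_mem` says that its values are in `W(X) ∪ {1}`. -/
noncomputable def red (p : Word X) : Word X :=
  WithOne.recOneCoe 1 redNonempty p

/-- The left-normed product `v v₁ v₂ … vₙ` where `u = vₙ … v₂ v₁` left-normed with `vₙ` a letter. -/
def revMul (v : FreeMagma X) : FreeMagma X → FreeMagma X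
  | .of x => v * .of x
  | .mul a b => revMul (v * b) a

/-- The word `yᵗ = y'ₘ yₘ₋₁ … y₁`, where `y = y₁ y₂ … yₘ₋₁ y'ₘ` is the left-normed decomposition of
`y` whose first factor `y₁` is a letter. -/
def t : FreeMagma X → FreeMagma X
  | .of x => .of x
  | .mul u v => revMul v u

/-- The order on nonempty words: `lt u v` means `u < v`. Shorter words are smaller; letters are
compared as elements of `X`; words of the same length `≥ 2` are compared by their right factor,
and then by their left factor. -/
def lt [LinearOrder X] : FreeMagma X → FreeMagma X → Prop
  | .of x, .of y => x < y
  | .of _, .mul _ _ => True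
  | .mul _ _, .of _ => False
  | .mul u₁ u₂, .mul v₁ v₂ =>
      (u₁ * u₂).length < (v₁ * v₂).length ∨
        ((u₁ * u₂).length = (v₁ * v₂).length ∧ (lt u₂ v₂ ∨ (u₂ = v₂ ∧ lt u₁ v₁)))

open scoped Classical in
/-- The word `y₀ = min {yᵗ, yᵗᵗ}`. -/
noncomputable def minT [LinearOrder X] (y : FreeMagma X) : FreeMagma X :=
  if lt (t y) (t (t y)) then t y else t (t y)

/-- The set `D(X)` of all `y₀` with `y, y₀, y₀ᵗ ∈ W` and `y₀ᵗ ≠ y₀`. -/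
def D (X : Type*) [LinearOrder X] : Set (FreeMagma X) :=
  {z | ∃ y ∈ W X, z = minT y ∧ minT y ∈ W X ∧ t (minT y) ∈ W X ∧ t (minT y) ≠ minT y}

/-- The increasing sequence `R₁ ⊆ R₂ ⊆ …`, indexed from `0`: `Rstage X n` is `Rₙ₊₁`. -/
def Rstage (X : Type*) [LinearOrder X] : ℕ → Set (FreeMagma X)
  | 0 => Set.range FreeMagma.of
  | n + 1 => Rstage X n ∪
      {y | y ∈ D X ∧ y.length ≤ n + 2 ∧
        ∃ l : List (FreeMagma X), (∀ u ∈ l, u ∈ Rstage X n) ∧ (y : Word X) = leftProd l}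

/-- The set `R(X) = ⋃ₙ Rₙ`. -/
def R (X : Type*) [LinearOrder X] : Set (FreeMagma X) :=
  ⋃ n, Rstage X n

/-- The set `B(X)`: the empty word, and the words in `W(X)` that are left-normed products of
elements of `R(X)`. -/
def B (X : Type*) [LinearOrder X] : Set (Word X) :=
  {1} ∪ {p | ∃ y ∈ W X, p = (y : Word X) ∧
    ∃ l : List (FreeMagma X), (∀ u ∈ l, u ∈ R X) ∧ (y : Word X) = leftProd l}

theorem mem_W_of (x : X) : FreeMagma.of x ∈ W X := by
  simp only [W, C, sub, Set.mem_ofPred_eq, Set.singleton_inter_eq_empty]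
  rintro (⟨u, hu⟩ | ⟨u, v, hu⟩) <;> cases hu

theorem mem_W_mul (u v : FreeMagma X) :
    u * v ∈ W X ↔ u ∈ W X ∧ v ∈ W X ∧ u ≠ v ∧ ∀ a, u ≠ a * v := by
  have key : u * v ∉ C X ↔ u ≠ v ∧ ∀ a, u ≠ a * v := by
    constructor
    · intro h
      refine ⟨fun e => h (Or.inl ⟨u, by rw [e]⟩), fun a e => h (Or.inr ⟨a, v, by rw [e]⟩)⟩
    · rintro ⟨h1, h2⟩ (⟨w, hw⟩ | ⟨a, w, hw⟩)
      · injection hw with e1 e2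
        exact h1 (e1.trans e2.symm)
      · injection hw with e1 e2
        exact h2 a (e1.trans (by rw [e2]))
  rw [← key]
  change ({u * v} ∪ sub u ∪ sub v) ∩ C X = ∅ ↔ sub u ∩ C X = ∅ ∧ sub v ∩ C X = ∅ ∧ _
  rw [Set.union_inter_distrib_right, Set.union_inter_distrib_right, Set.union_empty_iff,
    Set.union_empty_iff, Set.singleton_inter_eq_empty]
  tauto

theorem red_one : red (1 : Word X) = 1 := rfl

theorem red_of (x : X) : red (FreeMagma.of x : Word X) = (FreeMagma.of x : Word X) := rfl

theorem redMul_self (u : FreeMagma X) : redMul u u = 1 := by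
  cases u with
  | of x => exact if_pos rfl
  | mul a b => exact if_pos rfl

theorem redMul_of_mem_W {u v : FreeMagma X} (h : u * v ∈ W X) :
    redMul u v = ((u * v : FreeMagma X) : Word X) := by
  obtain ⟨-, -, h1, h2⟩ := (mem_W_mul u v).1 h
  cases u with
  | of x => exact if_neg h1
  | mul a b =>
    exact (if_neg h1).trans (if_neg (fun e => h2 a (by rw [← e]; rfl)))

/-- `π` fixes every element of `W(X)`. -/
theorem red_of_mem_W {u : FreeMagma X} (h : u ∈ W X) : red (u : Word X) = (u : Word X) := by
  induction u with
  | ih1 x => rfl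
  | ih2 a b iha ihb =>
    obtain ⟨ha, hb, -, -⟩ := (mem_W_mul a b).1 h
    change redMulWord (red (a : Word X)) (red (b : Word X)) = _
    rw [iha ha, ihb hb]
    exact redMul_of_mem_W h

theorem red_self {u : FreeMagma X} (h : u ∈ W X) : red ((u : Word X) * (u : Word X)) = 1 := by
  change redMulWord (red (u : Word X)) (red (u : Word X)) = _
  rw [red_of_mem_W h]
  exact redMul_self u

theorem red_cancel {a v : FreeMagma X} (h : a * v ∈ W X) :
    red (((a * v : FreeMagma X) : Word X) * (v : Word X)) = (a : Word X) := by
  change redMulWord (red ((a * v : FreeMagma X) : Word X)) (red (v : Word X)) = _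
  rw [red_of_mem_W h, red_of_mem_W ((mem_W_mul a v).1 h).2.1]
  have hne : a * v ≠ v := by
    intro e
    have := congrArg FreeMagma.length e
    have := FreeMagma.length_pos a
    simp only [FreeMagma.length] at *
    omega
  exact (if_neg hne).trans (if_pos rfl)

theorem red_mul_of_mem_W {u v : FreeMagma X} (h : u * v ∈ W X) :
    red ((u : Word X) * (v : Word X)) = (u : Word X) * (v : Word X) :=
  red_of_mem_W h

theorem redMul_mem {u v : FreeMagma X} (hu : u ∈ W X) (hv : v ∈ W X) :
    redMul u v = 1 ∨ ∃ w ∈ W X, redMul u v = (w : Word X) := by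
  by_cases h : u * v ∈ W X
  · exact Or.inr ⟨_, h, redMul_of_mem_W h⟩
  · by_cases h1 : u = v
    · subst h1
      exact Or.inl (redMul_self u)
    · have h2 : ∃ a, u = a * v := by
        by_contra h3
        exact h ((mem_W_mul u v).2 ⟨hu, hv, h1, fun a e => h3 ⟨a, e⟩⟩)
      obtain ⟨a, rfl⟩ := h2
      exact Or.inr ⟨a, ((mem_W_mul a v).1 hu).1, (if_neg h1).trans (if_pos rfl)⟩

theorem red_mem (p : Word X) : red p = 1 ∨ ∃ w ∈ W X, red p = (w : Word X) := by
  induction p using WithOne.recOneCoe with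
  | one => exact Or.inl rfl
  | coe u =>
    induction u with
    | ih1 x => exact Or.inr ⟨_, mem_W_of x, rfl⟩
    | ih2 a b iha ihb =>
      change redMulWord (red (a : Word X)) (red (b : Word X)) = 1 ∨
        ∃ w ∈ W X, redMulWord (red (a : Word X)) (red (b : Word X)) = (w : Word X)
      rcases iha with ha | ⟨u, hu, ha⟩ <;> rcases ihb with hb | ⟨v, hv, hb⟩ <;> rw [ha, hb]
      · exact Or.inl rfl
      · exact Or.inr ⟨v, hv, rfl⟩
      · exact Or.inr ⟨u, hu, rfl⟩
      · exact redMul_mem hu hv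

theorem red_red (p : Word X) : red (red p) = red p := by
  rcases red_mem p with h | ⟨w, hw, h⟩ <;> rw [h]
  · rfl
  · exact red_of_mem_W hw

theorem red_mul_eq (p q : Word X) : red (p * q) = redMulWord (red p) (red q) := by
  induction p using WithOne.recOneCoe with
  | one => rw [one_mul]; rfl
  | coe u =>
    induction q using WithOne.recOneCoe with
    | one =>
      rw [mul_one, red_one]
      rcases red_mem (u : Word X) with h | ⟨w, -, h⟩ <;> rw [h] <;> rfl
    | coe v => rfl

theorem red_mul (p q : Word X) : red (p * q) = red (red p * red q) := by
  rw [red_mul_eq, red_mul_eq (red p), red_red, red_red]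

end FreeBol

/-! ### Left-normed factor lists and the reversal `t`. -/

namespace FreeBol

variable {X : Type*}

/-! Right multiplication by a reduced word `v`, followed by reduction, is an involution of the
reduced words. Pair it with the action of the generator `v` of a free product of groups of order
two. The product in the theorem is the image of the empty word 1 under a conjugate A c A⁻¹ of such
an involution (`reflection`). The second component recovers the list from this conjugate
(`eq_of_reflection_eq`). It remains to see that each nonempty `y` in `B` is r·1 for exactly one
reflection r.

Uniqueness. A product of generators from `R` lies in `loopGroup`, whose elements fix 1, or is `path
b` times such an element, with `path b`·1 = b (`exists_eq_path_mul`). Hence every reflection is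
k⁻¹ρk with k in `loopGroup` and ρ either the path of a palindrome or the involution of a nonletter
of `R` (`exists_special`); here ρ·1 is some y which is reduced along with yᵗ. If two reflections
agree at 1, an element of `loopGroup` carries one such y to the other, y'. By ping-pong
(`prod_signedLoop_mem_pongSet`) that element is trivial unless {y, y'} = {u, uᵗ} for a nonletter u
of `R`. Taking a minimum in the definition of `D` makes uᵗ impossible (`Special.ne_t`), so the
reflections coincide.

Existence. If (`path y`)⁻¹·1 = r·1 for a reflection r, the conjugate of r by `path y` sends 1 to y
(`IsReflected.of_inv_path`). That word is either shorter than y or equal to yᵗ. By induction on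
length and two applications, only the case of reduced yᵗ and yᵗᵗ is left. If they are equal, yᵗ is a
palindrome and its path is a reflection; otherwise the smaller one lies in `R`. -/

theorem mul_eq_mul_iff {a b c d : FreeMagma X} : a * b = c * d ↔ a = c ∧ b = d :=
  ⟨fun h => by injection h with h1 h2; exact ⟨h1, h2⟩, fun h => by rw [h.1, h.2]⟩

theorem length_mul (a b : FreeMagma X) : (a * b).length = a.length + b.length := rfl

theorem ne_mul_right (a b : FreeMagma X) : b ≠ a * b := fun e => by
  have h := congrArg FreeMagma.length e
  have := a.length_pos
  rw [length_mul] at h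
  omega

/-- The factors of the left-normed decomposition of a word, starting from the last one. -/
def fac : FreeMagma X → List (FreeMagma X)
  | .of x => [.of x]
  | .mul a v => v :: fac a

/-- The last factor of the left-normed decomposition of a word. -/
def top : FreeMagma X → FreeMagma X
  | .of x => .of x
  | .mul _ v => v

@[simp] theorem fac_of (x : X) : fac (FreeMagma.of x) = [FreeMagma.of x] := rfl
@[simp] theorem fac_mul (a v : FreeMagma X) : fac (a * v) = v :: fac a := rfl
@[simp] theorem top_of (x : X) : top (FreeMagma.of x) = FreeMagma.of x := rfl
@[simp] theorem top_mul (a v : FreeMagma X) : top (a * v) = v := rfl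

theorem fac_ne_nil (y : FreeMagma X) : fac y ≠ [] := by
  cases y <;> exact List.cons_ne_nil _ _

theorem fac_eq_top_cons (y : FreeMagma X) : ∃ L, fac y = top y :: L := by
  cases y <;> exact ⟨_, rfl⟩

theorem top_eq_of_fac_eq {y f : FreeMagma X} {L : List (FreeMagma X)} (h : fac y = f :: L) :
    top y = f := by
  obtain ⟨L', h'⟩ := fac_eq_top_cons y
  rw [h'] at h
  exact (List.cons.inj h).1

theorem fac_injective : Function.Injective (fac (X := X)) := by
  intro y
  induction y with
  | ih1 x =>
    intro z h
    induction z with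
    | ih1 x' => simpa using h
    | ih2 c d _ _ =>
      have := (List.cons.inj h).2
      exact absurd this.symm (fac_ne_nil c)
  | ih2 a b iha ihb =>
    intro z h
    induction z with
    | ih1 x' => exact absurd (List.cons.inj h).2 (fac_ne_nil a)
    | ih2 c d _ _ =>
      obtain ⟨h1, h2⟩ := List.cons.inj h
      rw [h1, iha h2]

theorem exists_fac_eq_concat (y : FreeMagma X) : ∃ x L, fac y = L ++ [FreeMagma.of x] := by
  induction y with
  | ih1 x => exact ⟨x, [], rfl⟩
  | ih2 a b iha _ =>
    obtain ⟨x, L, h⟩ := iha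
    exact ⟨x, b :: L, by rw [fac_mul, h]; rfl⟩

theorem length_eq_sum_fac (y : FreeMagma X) : y.length = ((fac y).map FreeMagma.length).sum := by
  induction y with
  | ih1 x => rfl
  | ih2 a b iha _ => rw [length_mul, fac_mul, List.map_cons, List.sum_cons, ← iha, add_comm]

theorem mem_W_of_fac {y : FreeMagma X} (hy : y ∈ W X) : ∀ f ∈ fac y, f ∈ W X := by
  induction y with
  | ih1 x => intro f hf; rw [fac_of, List.mem_singleton] at hf; rwa [hf]
  | ih2 a b iha _ =>
    have h := (mem_W_mul a b).1 hy
    intro f hf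
    rcases List.mem_cons.1 hf with rfl | hf
    · exact h.2.1
    · exact iha h.1 f hf

/-- Every nonempty final segment of `fac y` is the factor list of a word of `W`. -/
theorem exists_mem_W_of_fac_eq_append {y : FreeMagma X} {M N : List (FreeMagma X)} (hy : y ∈ W X)
    (h : fac y = M ++ N) (hN : N ≠ []) : ∃ z ∈ W X, fac z = N := by
  induction M generalizing y with
  | nil => exact ⟨y, hy, h⟩
  | cons f M ih =>
    induction y with
    | ih1 x => exact absurd (List.append_eq_nil_iff.1 (List.cons.inj h).2.symm).2 hN
    | ih2 a b _ _ => exact ih ((mem_W_mul a b).1 hy).1 (List.cons.inj h).2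

/-- Both forbidden patterns `u u` and `(u v) v` say that two adjacent factors agree: the first
matters when the left word is a letter, the second otherwise. -/
theorem top_ne_of_mul_mem_W {a v : FreeMagma X} (h : a * v ∈ W X) : top a ≠ v := by
  obtain ⟨-, -, h1, h2⟩ := (mem_W_mul a v).1 h
  induction a with
  | ih1 x => exact h1
  | ih2 a b _ _ => rintro rfl; exact h2 a rfl

theorem isChain_fac {y : FreeMagma X} (hy : y ∈ W X) : (fac y).IsChain (· ≠ ·) := by
  induction y with
  | ih1 x => exact List.isChain_singleton _
  | ih2 a b iha _ =>
    have h := iha ((mem_W_mul a b).1 hy).1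
    have h1 := top_ne_of_mul_mem_W hy
    obtain ⟨L, hL⟩ := fac_eq_top_cons a
    rw [fac_mul, hL, List.isChain_cons_cons, ← hL]
    exact ⟨h1.symm, h⟩

theorem fac_revMul (v u : FreeMagma X) : fac (revMul v u) = (fac u).reverse ++ fac v := by
  induction u generalizing v with
  | ih1 x => rfl
  | ih2 a b iha _ =>
    change fac (revMul (v * b) a) = _
    rw [iha]
    simp

theorem fac_t_mul (u v : FreeMagma X) : fac (t (u * v)) = (fac u).reverse ++ fac v :=
  fac_revMul v u

theorem top_t (y : FreeMagma X) : ∃ x, top (t y) = FreeMagma.of x := by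
  induction y with
  | ih1 x => exact ⟨x, rfl⟩
  | ih2 a b _ _ =>
    obtain ⟨x, L, h⟩ := exists_fac_eq_concat a
    exact ⟨x, top_eq_of_fac_eq (L := L.reverse ++ fac b) (by rw [fac_t_mul, h]; simp)⟩

/-- The last factor of `y` comes first in `t y` and is itself split into factors there; only when it
is a letter is the list exactly reversed. -/
theorem fac_t {y : FreeMagma X} (h : ∃ x, top y = FreeMagma.of x) :
    fac (t y) = (fac y).reverse := by
  obtain ⟨x, hx⟩ := h
  induction y with
  | ih1 x => rfl
  | ih2 a b _ _ =>
    rw [top_mul] at hx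
    rw [fac_t_mul, hx]
    simp

theorem t_t {y : FreeMagma X} (h : ∃ x, top y = FreeMagma.of x) : t (t y) = y :=
  fac_injective (by rw [fac_t (top_t y), fac_t h, List.reverse_reverse])

theorem leftProd_concat (l : List (FreeMagma X)) (v : FreeMagma X) :
    leftProd (l ++ [v]) = leftProd l * v := by
  simp [leftProd, List.foldl_append]

/-- Only the first entry of a left-normed product is split further. -/
theorem fac_leftProd {u : FreeMagma X} {l : List (FreeMagma X)} :
    ∃ y : FreeMagma X, leftProd (u :: l) = y ∧ fac y = l.reverse ++ fac u := by
  induction l using List.reverseRecOn with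
  | nil => exact ⟨u, rfl, rfl⟩
  | append_singleton l v ih =>
    obtain ⟨y, h1, h2⟩ := ih
    refine ⟨y * v, ?_, by rw [fac_mul, h2]; simp⟩
    rw [← List.cons_append]
    rw [leftProd_concat, h1]
    rfl

theorem leftProd_reverse_fac (y : FreeMagma X) : leftProd (fac y).reverse = y := by
  induction y with
  | ih1 x => rfl
  | ih2 a b iha _ =>
    rw [fac_mul, List.reverse_cons, leftProd_concat, iha]
    rfl

theorem mem_fac_of_eq_leftProd {y : FreeMagma X} {l : List (FreeMagma X)} {s : Set (FreeMagma X)}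
    (hl : ∀ u ∈ l, u ∈ s ∧ ∀ f ∈ fac u, f ∈ s) (h : (y : Word X) = leftProd l) :
    ∀ f ∈ fac y, f ∈ s := by
  cases l with
  | nil => exact absurd h (WithOne.coe_ne_one)
  | cons u l =>
    obtain ⟨z, h1, h2⟩ := fac_leftProd (u := u) (l := l)
    have : y = z := WithOne.coe_inj.1 (h.trans h1)
    intro f hf
    rw [this, h2, List.mem_append, List.mem_reverse] at hf
    rcases hf with hf | hf
    · exact (hl f (List.mem_cons_of_mem _ hf)).1
    · exact (hl u List.mem_cons_self).2 f hf

/-! ### The order, and the sets `D`, `R` and `B` in terms of factors. -/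

section Order

variable [LinearOrder X]

theorem lt_asymm' {u v : FreeMagma X} (h : lt u v) : ¬ lt v u := by
  induction u generalizing v with
  | ih1 x =>
    cases v with
    | of y => exact lt_asymm (a := x) (b := y) h
    | mul c d => exact id
  | ih2 a b iha ihb =>
    cases v with
    | of y => exact h.elim
    | mul c d =>
      change _ ∨ _ ∧ (lt b d ∨ b = d ∧ lt a c) at h
      rintro (h' | ⟨h1, h'⟩)
      · rcases h with h | ⟨h, -⟩
        · exact lt_asymm h h'
        · exact h'.ne' h
      · rcases h with h | ⟨-, h⟩
        · exact h.ne' h1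
        · rcases h with h | ⟨rfl, h⟩
          · rcases h' with h' | ⟨rfl, -⟩
            · exact ihb h h'
            · exact ihb h h
          · rcases h' with h' | ⟨-, h'⟩
            · exact ihb h' h'
            · exact iha h h'

theorem lt_trichotomy' (u v : FreeMagma X) : lt u v ∨ u = v ∨ lt v u := by
  induction u generalizing v with
  | ih1 x =>
    cases v with
    | of y => exact (lt_trichotomy x y).imp id (Or.imp (congrArg _) id)
    | mul c d => exact Or.inl trivial
  | ih2 a b iha ihb =>
    cases v with
    | of y => exact Or.inr (Or.inr trivial)
    | mul c d =>
      change (_ ∨ _ ∧ (lt b d ∨ b = d ∧ lt a c)) ∨ a * b = c * d ∨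
        (_ ∨ _ ∧ (lt d b ∨ d = b ∧ lt c a))
      rcases Nat.lt_trichotomy (a * b).length (c * d).length with h | h | h
      · exact Or.inl (Or.inl h)
      · rcases ihb d with h1 | rfl | h1
        · exact Or.inl (Or.inr ⟨h, Or.inl h1⟩)
        · rcases iha c with h2 | rfl | h2
          · exact Or.inl (Or.inr ⟨h, Or.inr ⟨rfl, h2⟩⟩)
          · exact Or.inr (Or.inl rfl)
          · exact Or.inr (Or.inr (Or.inr ⟨h.symm, Or.inr ⟨rfl, h2⟩⟩))
        · exact Or.inr (Or.inr (Or.inr ⟨h.symm, Or.inl h1⟩))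
      · exact Or.inr (Or.inr (Or.inl h))

theorem minT_eq (y : FreeMagma X) : minT y = t y ∨ minT y = t (t y) := by
  unfold minT
  split_ifs
  exacts [Or.inl rfl, Or.inr rfl]

theorem top_minT (y : FreeMagma X) : ∃ x, top (minT y) = FreeMagma.of x := by
  rcases minT_eq y with h | h <;> rw [h] <;> exact top_t _

theorem not_lt_t_minT (y : FreeMagma X) : ¬ lt (t (minT y)) (minT y) := by
  unfold minT
  split_ifs with h
  · exact lt_asymm' h
  · rwa [t_t (top_t y)]

/-- The properties of the words in `D` that do not involve the order. -/
theorem D_spec {u : FreeMagma X} (h : u ∈ D X) :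
    u ∈ W X ∧ (∃ x, top u = FreeMagma.of x) ∧ t u ∈ W X ∧ t u ≠ u ∧ t u ∉ D X := by
  obtain ⟨y, -, rfl, h1, h2, h3⟩ := h
  refine ⟨h1, top_minT y, h2, h3, ?_⟩
  rintro ⟨z, -, hz, -⟩
  -- If `t u` were also a minimum, neither of `u` and `t u` would be smaller, forcing `t u = u`.
  have h4 := not_lt_t_minT z
  rw [← hz, t_t (top_minT y)] at h4
  rcases lt_trichotomy' (t (minT y)) (minT y) with h | h | h
  exacts [not_lt_t_minT y h, h3 h, h4 h]

theorem Rstage_mono : Monotone (Rstage X) :=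
  monotone_nat_of_le_succ fun _ => Set.subset_union_left

theorem Rstage_subset_R (n : ℕ) : Rstage X n ⊆ R X := Set.subset_iUnion _ n

theorem of_mem_R (x : X) : FreeMagma.of x ∈ R X := Rstage_subset_R 0 ⟨x, rfl⟩

theorem mem_R_cases {u : FreeMagma X} (h : u ∈ R X) : (∃ x, u = FreeMagma.of x) ∨ u ∈ D X := by
  obtain ⟨n, h⟩ := Set.mem_iUnion.1 h
  induction n with
  | zero => obtain ⟨x, rfl⟩ := h; exact Or.inl ⟨x, rfl⟩
  | succ n ih => exact h.elim ih fun h => Or.inr h.1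

theorem mem_W_of_mem_R {u : FreeMagma X} (h : u ∈ R X) : u ∈ W X := by
  rcases mem_R_cases h with ⟨x, rfl⟩ | h
  exacts [mem_W_of x, (D_spec h).1]

theorem mem_R_of_mem_fac {u : FreeMagma X} (h : u ∈ R X) : ∀ f ∈ fac u, f ∈ R X := by
  obtain ⟨n, h⟩ := Set.mem_iUnion.1 h
  induction n generalizing u with
  | zero =>
    obtain ⟨x, rfl⟩ := h
    intro f hf
    rw [fac_of, List.mem_singleton] at hf
    rw [hf]
    exact of_mem_R x
  | succ n ih =>
    rcases h with h | ⟨-, -, l, hl, h⟩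
    · exact ih (Rstage_subset_R n h) h
    · exact mem_fac_of_eq_leftProd
        (fun u hu => ⟨Rstage_subset_R n (hl u hu), ih (Rstage_subset_R n (hl u hu)) (hl u hu)⟩) h

/-- Finitely many factors lie in a common stage, and going to a stage beyond the length of `u` meets
the length bound, which thus plays no role in the union. -/
theorem mem_R_of_mem_D {u : FreeMagma X} (h : u ∈ D X) (hf : ∀ f ∈ fac u, f ∈ R X) : u ∈ R X := by
  have key : ∀ l : List (FreeMagma X), (∀ f ∈ l, f ∈ R X) → ∃ n, ∀ f ∈ l, f ∈ Rstage X n := by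
    intro l
    induction l with
    | nil => exact fun _ => ⟨0, fun f hf => absurd hf List.not_mem_nil⟩
    | cons a l ih =>
      intro hl
      obtain ⟨n, hn⟩ := ih fun f hf => hl f (List.mem_cons_of_mem _ hf)
      obtain ⟨m, hm⟩ := Set.mem_iUnion.1 (hl a List.mem_cons_self)
      refine ⟨max m n, fun f hf => ?_⟩
      rcases List.mem_cons.1 hf with rfl | hf
      exacts [Rstage_mono (le_max_left m n) hm, Rstage_mono (le_max_right m n) (hn f hf)]
  obtain ⟨n, hn⟩ := key _ hf
  refine Rstage_subset_R (max n u.length + 1) (Or.inr ⟨h, ?_, (fac u).reverse, ?_, ?_⟩)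
  · exact (le_max_right n u.length).trans (Nat.le_add_right _ 2)
  · exact fun f hf => Rstage_mono (le_max_left _ _) (hn f (List.mem_reverse.1 hf))
  · exact (leftProd_reverse_fac u).symm

theorem mem_R_of_mem_B {y : FreeMagma X} (h : (y : Word X) ∈ B X) :
    y ∈ W X ∧ ∀ f ∈ fac y, f ∈ R X := by
  rcases h with h | ⟨z, hz, h, l, hl, h'⟩
  · exact absurd h WithOne.coe_ne_one
  · obtain rfl := WithOne.coe_inj.1 h
    exact ⟨hz, mem_fac_of_eq_leftProd (fun u hu => ⟨hl u hu, mem_R_of_mem_fac (hl u hu)⟩) h'⟩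

end Order

end FreeBol

namespace FreeBol

variable {X : Type*}

/-! ### Right multiplications as involutions of the reduced words. -/

section RightMul

theorem redMul_mul_cancel (a v : FreeMagma X) : redMul (a * v) v = (a : Word X) :=
  (if_neg (ne_mul_right a v).symm).trans (if_pos rfl)

/-- The words fixed by `red`. -/
abbrev RedWord (X : Type*) : Type _ := {p : Word X // p = 1 ∨ ∃ w ∈ W X, p = (w : Word X)}

/-- The empty word as a reduced word. -/
def nilWord : RedWord X := ⟨1, Or.inl rfl⟩

/-- A nonempty reduced word. -/
def mkWord (y : FreeMagma X) (h : y ∈ W X) : RedWord X := ⟨y, Or.inr ⟨y, h, rfl⟩⟩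

theorem RedWord.cases (s : RedWord X) : s = nilWord ∨ ∃ y h, s = mkWord y h := by
  obtain ⟨p, rfl | ⟨w, h, rfl⟩⟩ := s
  exacts [Or.inl rfl, Or.inr ⟨w, h, rfl⟩]

theorem mkWord_inj {y z : FreeMagma X} {hy : y ∈ W X} {hz : z ∈ W X} :
    mkWord y hy = mkWord z hz ↔ y = z :=
  ⟨fun h => WithOne.coe_inj.1 (congrArg Subtype.val h), fun h => by subst h; rfl⟩

theorem mkWord_ne_nilWord {y : FreeMagma X} {hy : y ∈ W X} : mkWord y hy ≠ nilWord :=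
  fun h => WithOne.coe_ne_one (congrArg Subtype.val h)

open scoped Classical in
/-- Right multiplication of reduced words by `v`; the identity if `v` is not reduced. -/
noncomputable def rightMul (v : FreeMagma X) (s : RedWord X) : RedWord X :=
  if hv : v ∈ W X then
    ⟨redMulWord s.1 v, by
      obtain ⟨p, rfl | ⟨w, h, rfl⟩⟩ := s
      · exact Or.inr ⟨v, hv, rfl⟩
      · exact redMul_mem h hv⟩
  else s

theorem rightMul_val {v : FreeMagma X} (hv : v ∈ W X) (s : RedWord X) :
    (rightMul v s).1 = redMulWord s.1 v := by
  rw [rightMul, dif_pos hv]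

theorem rightMul_nilWord {v : FreeMagma X} (hv : v ∈ W X) :
    rightMul v nilWord = mkWord v hv :=
  Subtype.ext (rightMul_val hv _)

theorem rightMul_self {v : FreeMagma X} (hv : v ∈ W X) :
    rightMul v (mkWord v hv) = nilWord :=
  Subtype.ext ((rightMul_val hv _).trans (redMul_self v))

theorem rightMul_cancel {a v : FreeMagma X} (h : a * v ∈ W X) :
    rightMul v (mkWord (a * v) h) = mkWord a ((mem_W_mul a v).1 h).1 :=
  Subtype.ext ((rightMul_val ((mem_W_mul a v).1 h).2.1 _).trans (redMul_mul_cancel a v))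

theorem rightMul_push {a v : FreeMagma X} (h : a * v ∈ W X) :
    rightMul v (mkWord a ((mem_W_mul a v).1 h).1) = mkWord (a * v) h :=
  Subtype.ext ((rightMul_val ((mem_W_mul a v).1 h).2.1 _).trans (redMul_of_mem_W h))

theorem mul_mem_W_cases {u v : FreeMagma X} (hu : u ∈ W X) (hv : v ∈ W X) :
    u = v ∨ (∃ a, u = a * v) ∨ u * v ∈ W X := by
  by_contra! h
  exact h.2.2 ((mem_W_mul u v).2 ⟨hu, hv, h.1, h.2.1⟩)

/-- Appending `v` and removing a last factor `v` undo each other, as do 1 ↦ `v` and `v` ↦ 1. -/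
theorem rightMul_involutive (v : FreeMagma X) : Function.Involutive (rightMul v) := by
  intro s
  by_cases hv : v ∈ W X
  · rcases s.cases with rfl | ⟨y, hy, rfl⟩
    · rw [rightMul_nilWord hv, rightMul_self]
    · rcases mul_mem_W_cases hy hv with rfl | ⟨a, rfl⟩ | h
      · rw [rightMul_self, rightMul_nilWord hv]
      · rw [rightMul_cancel hy, rightMul_push hy]
      · rw [rightMul_push h, rightMul_cancel h]
  · have h : ∀ s, rightMul v s = s := fun s => dif_neg hv
    rw [h, h]

end RightMul

/-! ### The free product of groups of order two, and reflections. -/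

section Toggle

variable {α : Type*}

/-- Lists without equal neighbours: the elements of the free product of groups of order two. -/
abbrev AltList (α : Type*) : Type _ := {l : List α // l.IsChain (· ≠ ·)}

open scoped Classical in
/-- Left multiplication by a generator, on lists without equal neighbours. -/
noncomputable def toggle (v : α) (l : AltList α) : AltList α :=
  if h : (v :: l.1).IsChain (· ≠ ·) then ⟨v :: l.1, h⟩ else ⟨l.1.tail, l.2.tail⟩

theorem toggle_push {v : α} {l : List α} (h : (v :: l).IsChain (· ≠ ·))
    (hl : l.IsChain (· ≠ ·)) : toggle v ⟨l, hl⟩ = ⟨v :: l, h⟩ :=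
  dif_pos h

theorem toggle_cancel {v : α} {l : List α} (h : (v :: l).IsChain (· ≠ ·))
    (hl : l.IsChain (· ≠ ·)) : toggle v ⟨v :: l, h⟩ = ⟨l, hl⟩ :=
  dif_neg fun h' : (v :: v :: l).IsChain (· ≠ ·) => (List.isChain_cons_cons.1 h').1 rfl

theorem toggle_involutive (v : α) : Function.Involutive (toggle v) := by
  rintro ⟨l, hl⟩
  by_cases h : (v :: l).IsChain (· ≠ ·)
  · rw [toggle_push h hl, toggle_cancel h hl]
  · cases l with
    | nil => exact absurd (List.isChain_singleton v) h
    | cons a l =>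
      obtain rfl : v = a := by
        by_contra hne
        exact h (List.isChain_cons_cons.2 ⟨hne, hl⟩)
      have hl' : l.IsChain (· ≠ ·) := hl.tail
      rw [toggle_cancel hl hl', toggle_push hl hl']

end Toggle

/-- Pairs of permutations of reduced words and of lists without equal neighbours. -/
abbrev PermPair (X : Type*) : Type _ :=
  Equiv.Perm (RedWord X) × Equiv.Perm (AltList (FreeMagma X))

/-- The pair of involutions attached to a word. -/
noncomputable def invol (v : FreeMagma X) : PermPair X :=
  ((rightMul_involutive v).toPerm, (toggle_involutive v).toPerm)

theorem invol_mul_self (v : FreeMagma X) : invol v * invol v = 1 :=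
  Prod.ext (Equiv.ext (rightMul_involutive v)) (Equiv.ext (toggle_involutive v))

theorem invol_inv (v : FreeMagma X) : (invol v)⁻¹ = invol v :=
  inv_eq_of_mul_eq_one_left (invol_mul_self v)

/-- The product of the pairs of involutions attached to the elements of a list. -/
noncomputable def prodInvol (L : List (FreeMagma X)) : PermPair X := (L.map invol).prod

@[simp] theorem prodInvol_nil : prodInvol ([] : List (FreeMagma X)) = 1 := rfl

theorem prodInvol_cons (v : FreeMagma X) (L : List (FreeMagma X)) :
    prodInvol (v :: L) = invol v * prodInvol L := by
  simp [prodInvol]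

theorem prodInvol_append (L M : List (FreeMagma X)) :
    prodInvol (L ++ M) = prodInvol L * prodInvol M := by
  simp [prodInvol]

theorem prodInvol_singleton (v : FreeMagma X) : prodInvol [v] = invol v := by
  simp [prodInvol]

theorem prodInvol_reverse (L : List (FreeMagma X)) : prodInvol L.reverse = (prodInvol L)⁻¹ := by
  induction L with
  | nil => simp
  | cons v L ih =>
    rw [List.reverse_cons, prodInvol_append, ih, prodInvol_singleton, prodInvol_cons, mul_inv_rev,
      invol_inv]

/-- The conjugate of `invol c` by the product of a list. -/
noncomputable def reflection (A : List (FreeMagma X)) (c : FreeMagma X) : PermPair X :=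
  prodInvol A * invol c * (prodInvol A)⁻¹

theorem reflection_eq_prodInvol (A : List (FreeMagma X)) (c : FreeMagma X) :
    reflection A c = prodInvol (A ++ c :: A.reverse) := by
  rw [reflection, prodInvol_append, prodInvol_cons, prodInvol_reverse, mul_assoc]

theorem prodInvol_fst_cons (v : FreeMagma X) (L : List (FreeMagma X)) (s : RedWord X) :
    (prodInvol (v :: L)).1 s = rightMul v ((prodInvol L).1 s) := by
  rw [prodInvol_cons]
  rfl

theorem reflection_mul_self (A : List (FreeMagma X)) (c : FreeMagma X) :
    reflection A c * reflection A c = 1 := by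
  have := invol_mul_self c
  unfold reflection
  rw [show ∀ g h : PermPair X, g * h * g⁻¹ * (g * h * g⁻¹) = g * (h * h) * g⁻¹ by intros; group,
    this]
  group

theorem prodInvol_snd_nil {L : List (FreeMagma X)} (h : L.IsChain (· ≠ ·)) :
    (prodInvol L).2 ⟨[], List.isChain_nil⟩ = ⟨L, h⟩ := by
  induction L with
  | nil => rfl
  | cons v L ih =>
    rw [prodInvol_cons]
    change toggle v ((prodInvol L).2 _) = _
    have hL : L.IsChain (· ≠ ·) := h.tail
    rw [ih hL, toggle_push h hL]

/-- The second component applied to the empty list returns the list itself. -/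
theorem prodInvol_injOn {L M : List (FreeMagma X)} (hL : L.IsChain (· ≠ ·))
    (hM : M.IsChain (· ≠ ·)) (h : prodInvol L = prodInvol M) : L = M := by
  have h1 := prodInvol_snd_nil hL
  rw [h, prodInvol_snd_nil hM] at h1
  exact (congrArg Subtype.val h1).symm

/-- The last entry of `L` acts first, whence the reversal. -/
theorem prodInvol_fst_nilWord_val {L : List (FreeMagma X)} (hL : ∀ v ∈ L, v ∈ W X) :
    ((prodInvol L).1 nilWord).1 = red (leftProd L.reverse) := by
  induction L with
  | nil => rfl
  | cons v L ih =>
    have hv := hL v List.mem_cons_self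
    rw [prodInvol_fst_cons, rightMul_val hv, ih fun u hu => hL u (List.mem_cons_of_mem _ hu),
      List.reverse_cons, leftProd_concat, red_mul_eq, red_of_mem_W hv]

theorem reflection_nilWord_val {A : List (FreeMagma X)} {c : FreeMagma X}
    (hA : ∀ v ∈ A, v ∈ W X) (hc : c ∈ W X) :
    ((reflection A c).1 nilWord).1 = red (symProd (A ++ [c])) := by
  rw [reflection_eq_prodInvol, prodInvol_fst_nilWord_val]
  · simp [symProd]
  · intro v hv
    simp only [List.mem_append, List.mem_cons, List.mem_reverse] at hv
    rcases hv with hv | rfl | hv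
    exacts [hA v hv, hc, hA v hv]

theorem isChain_sym {A : List (FreeMagma X)} {c : FreeMagma X}
    (h : (A ++ [c]).IsChain (· ≠ ·)) : (A ++ c :: A.reverse).IsChain (· ≠ ·) := by
  rw [List.isChain_split]
  refine ⟨h, ?_⟩
  have h1 := List.isChain_reverse.2 (h.imp fun _ _ => Ne.symm)
  simpa using h1

theorem eq_of_reflection_eq {A A' : List (FreeMagma X)} {c c' : FreeMagma X}
    (h : (A ++ [c]).IsChain (· ≠ ·)) (h' : (A' ++ [c']).IsChain (· ≠ ·))
    (e : reflection A c = reflection A' c') : A ++ [c] = A' ++ [c'] := by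
  rw [reflection_eq_prodInvol, reflection_eq_prodInvol] at e
  have e1 := prodInvol_injOn (isChain_sym h) (isChain_sym h') e
  have e2 := congrArg List.length e1
  simp only [List.length_append, List.length_cons, List.length_reverse] at e2
  obtain ⟨rfl, e3⟩ := List.append_inj e1 (by omega)
  rw [(List.cons.inj e3).1]

/-- Conjugating by `v` cancels a leading `v` of the conjugator, does nothing to the generator `v`
itself, and otherwise lengthens the list. -/
theorem exists_reflection_isChain (s : Set (FreeMagma X)) (A : List (FreeMagma X))
    (c : FreeMagma X) (hA : ∀ v ∈ A, v ∈ s) (hc : c ∈ s) :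
    ∃ A' c', (∀ v ∈ A', v ∈ s) ∧ c' ∈ s ∧ (A' ++ [c']).IsChain (· ≠ ·) ∧
      reflection A' c' = reflection A c := by
  induction A with
  | nil => exact ⟨[], c, hA, hc, List.isChain_singleton c, rfl⟩
  | cons v A ih =>
    obtain ⟨A', c', hA', hc', hch, e⟩ := ih fun u hu => hA u (List.mem_cons_of_mem _ hu)
    have hv := hA v List.mem_cons_self
    have e1 : reflection (v :: A) c = invol v * reflection A' c' * (invol v)⁻¹ := by
      rw [e, reflection, reflection, prodInvol_cons]
      group
    cases A' with
    | nil =>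
      by_cases hvc : v = c'
      · subst hvc
        refine ⟨[], v, hA', hc', hch, ?_⟩
        rw [e1, reflection]
        simp
      · refine ⟨[v], c', by simpa using hv, hc', by simpa using hvc, ?_⟩
        rw [e1, reflection, reflection, prodInvol_cons]
        group
    | cons a A' =>
      by_cases hva : v = a
      · subst hva
        refine ⟨A', c', fun u hu => hA' u (List.mem_cons_of_mem _ hu), hc', hch.tail, ?_⟩
        rw [e1, reflection, reflection, prodInvol_cons]
        rw [mul_inv_rev, invol_inv]
        rw [show ∀ a b d : PermPair X, a * (a * b * d * (b⁻¹ * a)) * a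
          = (a * a) * (b * d * b⁻¹) * (a * a) by intros; group, invol_mul_self]
        group
      · refine ⟨v :: a :: A', c', ?_, hc', List.isChain_cons_cons.2 ⟨hva, hch⟩, ?_⟩
        · intro u hu
          rcases List.mem_cons.1 hu with rfl | hu
          exacts [hv, hA' u hu]
        · rw [e1, reflection, reflection, prodInvol_cons v]
          group

/-- The element of the group carrying the empty word to `y`. -/
noncomputable def path (y : FreeMagma X) : PermPair X := prodInvol (fac y)

theorem path_of (x : X) : path (FreeMagma.of x) = invol (FreeMagma.of x) := prodInvol_singleton _

theorem path_mul (a v : FreeMagma X) : path (a * v) = invol v * path a := prodInvol_cons _ _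

theorem path_nilWord {y : FreeMagma X} (h : y ∈ W X) : (path y).1 nilWord = mkWord y h := by
  induction y with
  | ih1 x => rw [path_of]; exact rightMul_nilWord h
  | ih2 a b iha _ =>
    rw [path_mul]
    change rightMul b ((path a).1 nilWord) = _
    rw [iha ((mem_W_mul a b).1 h).1, rightMul_push h]

theorem inv_fst_eq_iff (g : PermPair X) (s u : RedWord X) : g⁻¹.1 s = u ↔ s = g.1 u :=
  Equiv.Perm.inv_eq_iff_eq

theorem inv_path_mkWord {y : FreeMagma X} (h : y ∈ W X) :
    (path y)⁻¹.1 (mkWord y h) = nilWord :=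
  (inv_fst_eq_iff _ _ _).2 (path_nilWord h).symm

theorem path_t {y : FreeMagma X} (h : ∃ x, top y = FreeMagma.of x) : path (t y) = (path y)⁻¹ := by
  rw [path, fac_t h, prodInvol_reverse, path]

end FreeBol

/-! ### Ping-pong for the elements fixing the empty word. -/

namespace FreeBol

variable {X : Type*}

/-- Acting on `z` by the inverse path of `b`, where `z` is longer than `b`, appends the factors of
`b` in reverse order. -/
theorem inv_path_mkWord_of_length_lt {b z : FreeMagma X} (hb : b ∈ W X) (hz : z ∈ W X)
    (hlt : b.length < z.length) (htop : ∀ a, z ≠ a * top b) :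
    ∃ p, ∃ hp : p ∈ W X, (path b)⁻¹.1 (mkWord z hz) = mkWord p hp ∧
      fac p = (fac b).reverse ++ fac z := by
  induction b generalizing z with
  | ih1 x =>
    have h : z * FreeMagma.of x ∈ W X :=
      (mem_W_mul _ _).2 ⟨hz, hb, fun e => by rw [e] at hlt; exact lt_irrefl _ hlt, htop⟩
    refine ⟨_, h, ?_, rfl⟩
    rw [path_of, invol_inv]
    exact rightMul_push h
  | ih2 a v iha _ =>
    obtain ⟨ha, hv, -, -⟩ := (mem_W_mul a v).1 hb
    rw [length_mul] at hlt
    have h : z * v ∈ W X :=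
      (mem_W_mul _ _).2 ⟨hz, hv, fun e => by rw [e] at hlt; omega, htop⟩
    -- The new last factor `v` differs from `top a` because `a * v` is reduced, so again nothing
    -- cancels.
    obtain ⟨p, hp, h1, h2⟩ := iha ha h (by rw [length_mul]; omega)
      (fun c e => top_ne_of_mul_mem_W hb (mul_eq_mul_iff.1 e).2.symm)
    refine ⟨p, hp, ?_, by rw [h2]; simp⟩
    rw [path_mul, mul_inv_rev, invol_inv, ← h1]
    exact congrArg (path a)⁻¹.1 (rightMul_push h)

/-- The words that, together with their reversals, are reduced, and whose last factor is a
letter. -/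
def Stable (y : FreeMagma X) : Prop :=
  y ∈ W X ∧ t y ∈ W X ∧ ∃ x, top y = FreeMagma.of x

theorem Stable.t {y : FreeMagma X} (h : Stable y) : Stable (t y) :=
  ⟨h.2.1, by rw [t_t h.2.2]; exact h.1, top_t y⟩

theorem Stable.inv_path_nilWord {y : FreeMagma X} (h : Stable y) :
    (path y)⁻¹.1 nilWord = mkWord (FreeBol.t y) h.2.1 := by
  rw [← path_t h.2.2, path_nilWord]

theorem not_mem_W_mul_self (u : FreeMagma X) : u * u ∉ W X :=
  fun h => ((mem_W_mul u u).1 h).2.2.1 rfl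

variable [LinearOrder X]

/-- The elements of `R` that are not letters. -/
abbrev RD (X : Type*) [LinearOrder X] : Type _ := {u : FreeMagma X // u ∈ R X ∧ u ∈ D X}

theorem RD.stable (u : RD X) : Stable u.1 :=
  have h := D_spec u.2.2
  ⟨h.1, h.2.2.1, h.2.1⟩

theorem RD.length_top_lt (u : RD X) : (top u.1).length < u.1.length := by
  obtain ⟨u, hu⟩ := u
  induction u with
  | ih1 x => exact absurd rfl (D_spec hu.2).2.2.2.1
  | ih2 a b _ _ =>
    have := a.length_pos
    rw [length_mul, top_mul]
    omega

theorem RD.ne_of (u : RD X) (x : X) : u.1 ≠ FreeMagma.of x := fun h => by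
  have := u.length_top_lt
  rw [h] at this
  exact lt_irrefl _ this

/-- This is where the choice of a minimum in `D` enters. -/
theorem RD.t_ne (u v : RD X) : t u.1 ≠ v.1 := fun h => by
  have := (D_spec u.2.2).2.2.2.2
  rw [h] at this
  exact this v.2.2

/-- The element of the stabilizer of the empty word attached to `u`. -/
noncomputable def loop (u : RD X) : PermPair X := invol u.1 * path u.1

theorem loop_nilWord (u : RD X) : (loop u).1 nilWord = nilWord := by
  change rightMul u.1 ((path u.1).1 nilWord) = _
  rw [path_nilWord u.stable.1, rightMul_self]

/-- The words `P u` with `P` nonempty. -/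
def endSet (u : RD X) : Set (RedWord X) := {s | ∃ P, ∃ h : P * u.1 ∈ W X, s = mkWord _ h}

/-- The words `P u uₙ … u₁` with `P` nonempty and `u = u₁ … uₙ`. -/
def endRevSet (u : RD X) : Set (RedWord X) :=
  {s | ∃ p, ∃ h : p ∈ W X, s = mkWord p h ∧ ∃ P, fac p = (fac u.1).reverse ++ u.1 :: fac P}

theorem mem_endRevSet_of_path_mem {u : RD X} {s : RedWord X} (h : (path u.1).1 s ∈ endSet u) :
    s ∈ endRevSet u := by
  obtain ⟨P, hP, h⟩ := h
  obtain ⟨p, hp, h1, h2⟩ := inv_path_mkWord_of_length_lt u.stable.1 hP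
    (by have := P.length_pos; rw [length_mul]; omega)
    (fun a e => by
      have := u.length_top_lt
      rw [← (mul_eq_mul_iff.1 e).2] at this
      exact lt_irrefl _ this)
  refine ⟨p, hp, ?_, P, h2⟩
  rw [← h1, ← h]
  exact ((inv_fst_eq_iff _ _ _).2 rfl).symm

theorem invol_mem_endSet {u : RD X} {s : RedWord X} (h : s ∉ endSet u) (h1 : s ≠ nilWord)
    (h2 : s ≠ mkWord u.1 u.stable.1) : (invol u.1).1 s ∈ endSet u := by
  rcases s.cases with rfl | ⟨y, hy, rfl⟩
  · exact absurd rfl h1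
  · rcases mul_mem_W_cases hy u.stable.1 with rfl | ⟨a, rfl⟩ | h3
    · exact absurd rfl h2
    · exact absurd ⟨a, hy, rfl⟩ h
    · exact ⟨y, h3, rightMul_push h3⟩

/-- The sets on which the words in the elements `loop u` play ping-pong. -/
def pongSet (x : RD X × Bool) : Set (RedWord X) := if x.2 then endSet x.1 else endRevSet x.1

/-- `loop u` or its inverse. -/
noncomputable def signedLoop (x : RD X × Bool) : PermPair X :=
  if x.2 then loop x.1 else (loop x.1)⁻¹

/-- The exceptional point of `signedLoop x`. -/
def excep (x : RD X × Bool) : RedWord X :=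
  if x.2 then mkWord (t x.1.1) x.1.stable.2.1 else mkWord x.1.1 x.1.stable.1

/-- `loop u` is `path u` followed by right multiplication by `u`. The latter appends `u` unless it
meets 1, `u` or a word ending in `u`; pulled back through `path u`, these become `t u`, 1 and a
subset of `endRevSet u`. For the inverse, appending `u` makes the word longer than `u`, so the
inverse path then only appends. -/
theorem signedLoop_mem_pongSet {x : RD X × Bool} {s : RedWord X}
    (h : s ∉ pongSet (x.1, !x.2)) (h1 : s ≠ nilWord) (h2 : s ≠ excep x) :
    (signedLoop x).1 s ∈ pongSet x := by
  obtain ⟨u, b⟩ := x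
  cases b with
  | true =>
    change (invol u.1).1 ((path u.1).1 s) ∈ endSet u
    refine invol_mem_endSet (fun h3 => h (mem_endRevSet_of_path_mem h3)) (fun h3 => h2 ?_)
      (fun h3 => h1 ?_)
    · exact ((inv_fst_eq_iff _ _ _).2 h3.symm).symm.trans u.stable.inv_path_nilWord
    · rw [← inv_path_mkWord u.stable.1]
      exact ((inv_fst_eq_iff _ _ _).2 h3.symm).symm
  | false =>
    change ((loop u)⁻¹).1 s ∈ endRevSet u
    apply mem_endRevSet_of_path_mem
    rw [loop, mul_inv_rev, invol_inv]
    change (path u.1 * (path u.1)⁻¹ * invol u.1).1 s ∈ _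
    rw [mul_inv_cancel, one_mul]
    exact invol_mem_endSet h h1 h2

theorem signedLoop_excep (x : RD X × Bool) :
    (signedLoop x).1 (excep x) = excep (x.1, !x.2) := by
  obtain ⟨u, b⟩ := x
  have key : (loop u).1 (mkWord (t u.1) u.stable.2.1) = mkWord u.1 u.stable.1 := by
    rw [← u.stable.inv_path_nilWord]
    change (invol u.1 * (path u.1 * (path u.1)⁻¹)).1 nilWord = _
    rw [mul_inv_cancel, mul_one]
    exact rightMul_nilWord _
  cases b with
  | true => exact key
  | false => exact (inv_fst_eq_iff _ _ _).2 key.symm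

theorem mkWord_not_mem_pongSet {y : FreeMagma X} (h : Stable y) (x : RD X × Bool) :
    mkWord y h.1 ∉ pongSet x := by
  obtain ⟨u, b⟩ := x
  cases b with
  | true =>
    rintro ⟨P, hP, e⟩
    obtain rfl := mkWord_inj.1 e
    obtain ⟨x, hx⟩ := h.2.2
    exact u.ne_of x hx
  | false =>
    rintro ⟨p, hp, e, P, hP⟩
    obtain rfl := mkWord_inj.1 e
    -- Reversing `y` would produce a reduced word beginning with `u u`.
    have h1 : fac (t y) = (fac P).reverse ++ fac (u.1 * u.1) := by
      rw [fac_t h.2.2, hP]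
      simp
    obtain ⟨z, hz, e⟩ := exists_mem_W_of_fac_eq_append h.2.1 h1 (fac_ne_nil _)
    rw [fac_injective e] at hz
    exact not_mem_W_mul_self _ hz

theorem nilWord_not_mem_pongSet (x : RD X × Bool) : nilWord ∉ pongSet x := by
  obtain ⟨u, b⟩ := x
  cases b with
  | true => rintro ⟨P, hP, e⟩; exact mkWord_ne_nilWord e.symm
  | false => rintro ⟨p, hp, e, -⟩; exact mkWord_ne_nilWord e.symm

/-- If the lengths differed, the longer word would begin with the square of the shorter, hence not
be reduced. -/
theorem eq_of_reverse_append_eq {u v : RD X} {L M : List (FreeMagma X)}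
    (h : (fac u.1).reverse ++ u.1 :: L = (fac v.1).reverse ++ v.1 :: M)
    (hle : (fac u.1).length ≤ (fac v.1).length) : u = v := by
  rcases hle.eq_or_lt with hl | hl
  · have := (List.append_inj h (by simpa using hl)).1
    exact Subtype.ext (fac_injective (List.reverse_injective this))
  · exfalso
    have h1 : (fac u.1).reverse ++ [u.1] <+: (fac v.1).reverse := by
      refine List.prefix_of_prefix_length_le (l₃ := (fac v.1).reverse ++ v.1 :: M) ?_
        (List.prefix_append _ _) (by simpa using hl)
      rw [← h]
      exact ⟨L, by simp⟩
    obtain ⟨N, hN⟩ := h1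
    have h2 : fac v.1 = N.reverse ++ fac (u.1 * u.1) := by
      rw [← List.reverse_reverse (fac v.1), ← hN]
      simp
    obtain ⟨z, hz, e⟩ := exists_mem_W_of_fac_eq_append v.stable.1 h2 (fac_ne_nil _)
    rw [fac_injective e] at hz
    exact not_mem_W_mul_self _ hz

/-- The last factor is a nonletter in the first set and a letter in the second. -/
theorem endSet_disjoint_endRevSet {u v : RD X} {s : RedWord X} (h : s ∈ endSet u)
    (h' : s ∈ endRevSet v) : False := by
  obtain ⟨P, hP, rfl⟩ := h
  obtain ⟨p, hp, e, Q, hQ⟩ := h'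
  obtain rfl := mkWord_inj.1 e
  obtain ⟨x, L, hx⟩ := exists_fac_eq_concat v.1
  rw [hx, fac_mul, List.reverse_concat, List.cons_append] at hQ
  exact u.ne_of x (List.cons.inj hQ).1

theorem pongSet_disjoint {x y : RD X × Bool} {s : RedWord X} (h : s ∈ pongSet x)
    (h' : s ∈ pongSet y) : x = y := by
  obtain ⟨u, b⟩ := x
  obtain ⟨v, c⟩ := y
  cases b <;> cases c
  · obtain ⟨p, hp, rfl, P, hP⟩ := h
    obtain ⟨q, hq, e, Q, hQ⟩ := h'
    obtain rfl := mkWord_inj.1 e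
    rw [hP] at hQ
    rcases le_total (fac u.1).length (fac v.1).length with hl | hl
    · exact congrArg (·, false) (eq_of_reverse_append_eq hQ hl)
    · exact congrArg (·, false) (eq_of_reverse_append_eq hQ.symm hl).symm
  · exact (endSet_disjoint_endRevSet h' h).elim
  · exact (endSet_disjoint_endRevSet h h').elim
  · obtain ⟨P, hP, rfl⟩ := h
    obtain ⟨Q, hQ, e⟩ := h'
    exact congrArg (·, true) (Subtype.ext (mul_eq_mul_iff.1 (mkWord_inj.1 e)).2)

theorem excep_stable (x : RD X × Bool) : ∃ y, ∃ h : Stable y, excep x = mkWord y h.1 := by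
  obtain ⟨u, b⟩ := x
  cases b
  exacts [⟨_, u.stable, rfl⟩, ⟨_, u.stable.t, rfl⟩]

theorem excep_injective : Function.Injective (excep (X := X)) := by
  rintro ⟨u, b⟩ ⟨v, c⟩ h
  cases b <;> cases c
  · exact congrArg (·, false)
      (Subtype.ext ((mkWord_inj (hy := u.stable.1) (hz := v.stable.1)).1 h))
  · exact (v.t_ne u ((mkWord_inj (hy := u.stable.1) (hz := v.stable.2.1)).1 h).symm).elim
  · exact (u.t_ne v ((mkWord_inj (hy := u.stable.2.1) (hz := v.stable.1)).1 h)).elim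
  · have h1 := congrArg t ((mkWord_inj (hy := u.stable.2.1) (hz := v.stable.2.1)).1 h)
    rw [t_t u.stable.2.2, t_t v.stable.2.2] at h1
    exact congrArg (·, true) (Subtype.ext h1)

theorem lift_loop_mk (L : List (RD X × Bool)) :
    FreeGroup.lift loop (FreeGroup.mk L) = (L.map signedLoop).prod := by
  rw [FreeGroup.lift_mk]
  congr 1
  refine List.map_congr_left fun x _ => ?_
  obtain ⟨u, b⟩ := x
  cases b <;> rfl

/-- Ping-pong: a nontrivial reduced word in the elements `loop u` carries a stable word to one of
the sets `pongSet`, except that `loop u` exchanges `uᵗ` and `u`. -/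
theorem prod_signedLoop_mem_pongSet {s : RedWord X} {y : FreeMagma X} (hy : Stable y)
    (hs : s = mkWord y hy.1) (x : RD X × Bool) (L : List (RD X × Bool))
    (hL : FreeGroup.IsReduced (x :: L)) :
    ((x :: L).map signedLoop).prod.1 s ∈ pongSet x ∨
      s = excep x ∧ ((x :: L).map signedLoop).prod.1 s = excep (x.1, !x.2) := by
  induction L generalizing x with
  | nil =>
    rw [List.map_singleton, List.prod_singleton]
    by_cases h : s = excep x
    · exact Or.inr ⟨h, by rw [h, signedLoop_excep]⟩
    · refine Or.inl (signedLoop_mem_pongSet ?_ ?_ h)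
      · rw [hs]; exact mkWord_not_mem_pongSet hy _
      · rw [hs]; exact mkWord_ne_nilWord
  | cons z L ih =>
    have hxz : z ≠ (x.1, !x.2) := by
      rintro rfl
      have := (List.isChain_cons_cons.1 hL).1 rfl
      simp at this
    left
    rw [List.map_cons, List.prod_cons]
    change (signedLoop x).1 (((z :: L).map signedLoop).prod.1 s) ∈ _
    rcases ih z (List.isChain_cons_cons.1 hL).2 with h | ⟨-, h⟩
    · refine signedLoop_mem_pongSet (fun h' => hxz (pongSet_disjoint h h')) (fun h' => ?_)
        (fun h' => ?_)
      · rw [h'] at h; exact nilWord_not_mem_pongSet _ h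
      · obtain ⟨w, hw, e⟩ := excep_stable x
        rw [h', e] at h
        exact mkWord_not_mem_pongSet hw _ h
    -- The exceptional image is again stable, and it is exceptional for `x` only if `x` is inverse
    -- to `z`, which reducedness excludes.
    · obtain ⟨w, hw, e⟩ := excep_stable (z.1, !z.2)
      rw [h]
      refine signedLoop_mem_pongSet ?_ ?_ (fun h' => hxz ?_)
      · rw [e]; exact mkWord_not_mem_pongSet hw _
      · rw [e]; exact mkWord_ne_nilWord
      · have := excep_injective h'
        rw [← this, Bool.not_not]

/-- The stabilizer of the empty word. -/
noncomputable def loopGroup (X : Type*) [LinearOrder X] : Subgroup (PermPair X) :=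
  (FreeGroup.lift (loop (X := X))).range

theorem loop_mem_loopGroup (u : RD X) : loop u ∈ loopGroup X :=
  ⟨FreeGroup.of u, FreeGroup.lift_apply_of⟩

theorem loopGroup_nilWord {k : PermPair X} (h : k ∈ loopGroup X) : k.1 nilWord = nilWord := by
  have hle : loopGroup X ≤
      (MulAction.stabilizer (Equiv.Perm (RedWord X)) (nilWord (X := X))).comap
        (MonoidHom.fst _ _) := by
    refine FreeGroup.range_lift_le ?_
    rintro _ ⟨u, rfl⟩
    exact loop_nilWord u
  exact hle h

/-- A nontrivial reduced word in the loops sends stable words into ping-pong sets, which contain no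
stable word, apart from the exceptional swap. -/
theorem eq_one_of_loopGroup_stable {k : PermPair X} (hk : k ∈ loopGroup X) {y z : FreeMagma X}
    (hy : Stable y) (hz : Stable z) (h : k.1 (mkWord y hy.1) = mkWord z hz.1) :
    k = 1 ∨ ∃ x, mkWord y hy.1 = excep x ∧ mkWord z hz.1 = excep (x.1, !x.2) := by
  obtain ⟨f, rfl⟩ := hk
  have hf : FreeGroup.mk f.toWord = f := FreeGroup.mk_toWord
  have hred : FreeGroup.IsReduced f.toWord := FreeGroup.isReduced_toWord
  rw [← hf, lift_loop_mk] at h ⊢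
  rcases hL : f.toWord with _ | ⟨x, L⟩
  · exact Or.inl rfl
  · rw [hL] at h hred
    right
    rcases prod_signedLoop_mem_pongSet hy rfl x L hred with h1 | ⟨h1, h2⟩
    · rw [h] at h1
      exact absurd h1 (mkWord_not_mem_pongSet hz _)
    · exact ⟨x, h1, h.symm.trans h2⟩

/-! ### Normal form of reflections modulo `loopGroup`, and uniqueness. -/

theorem invol_eq_or {v : FreeMagma X} (hv : v ∈ R X) :
    ∃ k ∈ loopGroup X, invol v * path v = k := by
  rcases mem_R_cases hv with ⟨x, rfl⟩ | h
  · exact ⟨1, one_mem _, by rw [path_of, invol_mul_self]⟩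
  · exact ⟨_, loop_mem_loopGroup ⟨v, hv, h⟩, rfl⟩

/-- Every product of generators is, up to the stabilizer of the empty word, the path of a word. -/
theorem exists_eq_path_mul {L : List (FreeMagma X)} (hL : ∀ v ∈ L, v ∈ R X) :
    ∃ k ∈ loopGroup X, prodInvol L = k ∨
      ∃ b ∈ W X, (∀ f ∈ fac b, f ∈ R X) ∧ prodInvol L = path b * k := by
  induction L with
  | nil => exact ⟨1, one_mem _, Or.inl rfl⟩
  | cons v L ih =>
    have hv := hL v List.mem_cons_self
    obtain ⟨k1, hk1, e1⟩ := invol_eq_or hv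
    obtain ⟨k, hk, h | ⟨b, hb, hbf, h⟩⟩ := ih fun u hu => hL u (List.mem_cons_of_mem _ hu)
    -- From `invol v * path v = k1` comes `invol v = path v * k1⁻¹`.
    · refine ⟨k1⁻¹ * k, mul_mem (inv_mem hk1) hk, Or.inr ⟨v, mem_W_of_mem_R hv,
        mem_R_of_mem_fac hv, ?_⟩⟩
      rw [prodInvol_cons, h, ← e1, mul_inv_rev, invol_inv]
      group
    · rw [prodInvol_cons, h]
      rcases mul_mem_W_cases hb (mem_W_of_mem_R hv) with rfl | ⟨a, rfl⟩ | h3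
      · exact ⟨k1 * k, mul_mem hk1 hk, Or.inl (by rw [← mul_assoc, e1])⟩
      · refine ⟨k, hk, Or.inr ⟨a, ((mem_W_mul a v).1 hb).1,
          fun f hf => hbf f (List.mem_cons_of_mem _ hf), ?_⟩⟩
        rw [path_mul, ← mul_assoc, ← mul_assoc, invol_mul_self, one_mul]
      · refine ⟨k, hk, Or.inr ⟨b * v, h3, ?_, by rw [path_mul, mul_assoc]⟩⟩
        intro f hf
        rcases List.mem_cons.1 hf with rfl | hf
        exacts [hv, hbf f hf]

/-- The words that represent the conjugacy classes of reflections: nonletters of `R` and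
palindromes. -/
def Special (ρ : PermPair X) (y : FreeMagma X) : Prop :=
  Stable y ∧ ((t y = y ∧ ρ = path y) ∨ (y ∈ R X ∧ y ∈ D X ∧ ρ = invol y))

theorem special_invol {c : FreeMagma X} (hc : c ∈ R X) : Special (invol c) c := by
  rcases mem_R_cases hc with ⟨x, rfl⟩ | h
  · exact ⟨⟨mem_W_of x, mem_W_of x, x, rfl⟩, Or.inl ⟨rfl, (path_of x).symm⟩⟩
  · exact ⟨RD.stable ⟨c, hc, h⟩, Or.inr ⟨hc, h, rfl⟩⟩

/-- Since `b * c` is reduced and longer than `b`, following it by the inverse path of `b` cancels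
nothing and traces a reduced palindrome with centre `c`. -/
theorem exists_special_of_mul_mem_W {b c : FreeMagma X} (h : b * c ∈ W X) :
    ∃ y, Special ((path b)⁻¹ * invol c * path b) y := by
  obtain ⟨hb, hc, -, -⟩ := (mem_W_mul b c).1 h
  obtain ⟨p, hp, -, h2⟩ := inv_path_mkWord_of_length_lt hb h
    (by have := c.length_pos; rw [length_mul]; omega)
    (fun a e => top_ne_of_mul_mem_W h (mul_eq_mul_iff.1 e).2.symm)
  have htop : ∃ x, top p = FreeMagma.of x := by
    obtain ⟨x, L, hx⟩ := exists_fac_eq_concat b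
    exact ⟨x, top_eq_of_fac_eq (L := L.reverse ++ c :: fac b) (by rw [h2]; simp [hx])⟩
  have hpal : t p = p := fac_injective (by rw [fac_t htop, h2]; simp)
  refine ⟨p, ⟨hp, by rwa [hpal], htop⟩, Or.inl ⟨hpal, ?_⟩⟩
  rw [show path p = prodInvol (fac p) from rfl, h2, prodInvol_append, prodInvol_reverse, fac_mul,
    prodInvol_cons, ← mul_assoc]
  rfl

theorem exists_special {A : List (FreeMagma X)} {c : FreeMagma X} (hA : ∀ v ∈ A, v ∈ R X)
    (hc : c ∈ R X) : ∃ k ∈ loopGroup X, ∃ ρ y, Special ρ y ∧ reflection A c = k⁻¹ * ρ * k := by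
  obtain ⟨k, hk, h⟩ := exists_eq_path_mul (L := A.reverse)
    fun v hv => hA v (List.mem_reverse.1 hv)
  rw [prodInvol_reverse] at h
  have hr : reflection A c = (prodInvol A)⁻¹⁻¹ * invol c * (prodInvol A)⁻¹ := by
    rw [inv_inv]; rfl
  rcases h with h | ⟨b, hb, -, h⟩
  · exact ⟨k, hk, _, c, special_invol hc, by rw [hr, h]⟩
  · rcases mul_mem_W_cases hb (mem_W_of_mem_R hc) with rfl | ⟨a, rfl⟩ | h3
    · obtain ⟨k1, hk1, e1⟩ := invol_eq_or hc
      -- Conjugating `invol b` by `path b` or by `k1 = invol b * path b` gives the same element.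
      refine ⟨k1 * k, mul_mem hk1 hk, _, b, special_invol hc, ?_⟩
      rw [hr, h, ← e1, mul_inv_rev, mul_inv_rev, mul_inv_rev]
      group
    · obtain ⟨y, hy⟩ := exists_special_of_mul_mem_W hb
      refine ⟨k, hk, _, y, hy, ?_⟩
      rw [hr, h, path_mul, mul_inv_rev, mul_inv_rev, invol_inv]
      rw [show ∀ g h : PermPair X, k⁻¹ * (g⁻¹ * h) * h * (h * g * k)
        = k⁻¹ * (g⁻¹ * (h * h) * h * g) * k by intros; group]
      rw [invol_mul_self, mul_one]
    · obtain ⟨y, hy⟩ := exists_special_of_mul_mem_W h3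
      refine ⟨k, hk, _, y, hy, ?_⟩
      rw [hr, h, mul_inv_rev]
      group

theorem Special.apply_nilWord {ρ : PermPair X} {y : FreeMagma X} (h : Special ρ y) :
    ρ.1 nilWord = mkWord y h.1.1 := by
  obtain ⟨hs, ⟨-, rfl⟩ | ⟨-, -, rfl⟩⟩ := h
  exacts [path_nilWord _, rightMul_nilWord _]

theorem Special.ne_t {ρ : PermPair X} {y : FreeMagma X} (h : Special ρ y) (u : RD X) :
    y ≠ t u.1 := by
  rintro rfl
  obtain ⟨hs, ⟨h, -⟩ | ⟨h1, h2, -⟩⟩ := h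
  · rw [t_t u.stable.2.2] at h
    exact (D_spec u.2.2).2.2.2.1 h.symm
  · exact u.t_ne ⟨_, h1, h2⟩ rfl

theorem Special.eq {ρ σ : PermPair X} {y : FreeMagma X} (h : Special ρ y) (h' : Special σ y) :
    ρ = σ := by
  obtain ⟨-, ⟨h1, rfl⟩ | ⟨-, h1, rfl⟩⟩ := h <;> obtain ⟨-, ⟨h2, rfl⟩ | ⟨-, h2, rfl⟩⟩ := h'
  · rfl
  · exact absurd h1 (D_spec h2).2.2.2.1
  · exact absurd h2 (D_spec h1).2.2.2.1
  · rfl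

/-- A reflection is determined by the image of the empty word. -/
theorem reflection_eq_of_apply_nilWord_eq {A A' : List (FreeMagma X)} {c c' : FreeMagma X}
    (hA : ∀ v ∈ A, v ∈ R X) (hc : c ∈ R X) (hA' : ∀ v ∈ A', v ∈ R X) (hc' : c' ∈ R X)
    (h : (reflection A c).1 nilWord = (reflection A' c').1 nilWord) :
    reflection A c = reflection A' c' := by
  obtain ⟨k, hk, ρ, y, hy, e⟩ := exists_special hA hc
  obtain ⟨k', hk', ρ', y', hy', e'⟩ := exists_special hA' hc'
  have h1 : k⁻¹.1 (mkWord y hy.1.1) = k'⁻¹.1 (mkWord y' hy'.1.1) := by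
    rw [e, e'] at h
    change k⁻¹.1 (ρ.1 (k.1 nilWord)) = k'⁻¹.1 (ρ'.1 (k'.1 nilWord)) at h
    rwa [loopGroup_nilWord hk, loopGroup_nilWord hk', hy.apply_nilWord, hy'.apply_nilWord] at h
  have h2 : (k' * k⁻¹).1 (mkWord y hy.1.1) = mkWord y' hy'.1.1 :=
    ((inv_fst_eq_iff _ _ _).1 h1.symm).symm
  rcases eq_one_of_loopGroup_stable (mul_mem hk' (inv_mem hk)) hy.1 hy'.1 h2 with
    h3 | ⟨⟨u, b⟩, h3, h4⟩
  · rw [h3] at h2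
    obtain rfl : y = y' := (mkWord_inj (hy := hy.1.1) (hz := hy'.1.1)).1 h2
    rw [e, e', hy.eq hy', mul_inv_eq_one.1 h3]
  -- In the exceptional case one of `y`, `y'` is `t u`.
  · cases b
    · exact absurd ((mkWord_inj (hy := hy'.1.1) (hz := u.stable.2.1)).1 h4) (hy'.ne_t u)
    · exact absurd ((mkWord_inj (hy := hy.1.1) (hz := u.stable.2.1)).1 h3) (hy.ne_t u)

end FreeBol

/-! ### Existence: descent on the length. -/

namespace FreeBol

variable {X : Type*}

/-- The length of a reduced word, `0` for the empty word. -/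
noncomputable def size (s : RedWord X) : ℕ := WithOne.recOneCoe 0 FreeMagma.length s.1

theorem size_nilWord : size (nilWord (X := X)) = 0 := rfl

theorem size_mkWord {y : FreeMagma X} (h : y ∈ W X) : size (mkWord y h) = y.length := rfl

theorem size_rightMul_le {v : FreeMagma X} (hv : v ∈ W X) (s : RedWord X) :
    size (rightMul v s) ≤ size s + v.length := by
  rcases s.cases with rfl | ⟨y, hy, rfl⟩
  · rw [rightMul_nilWord hv, size_nilWord, size_mkWord, zero_add]
  · rcases mul_mem_W_cases hy hv with rfl | ⟨a, rfl⟩ | h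
    · rw [rightMul_self]; exact Nat.zero_le _
    · rw [rightMul_cancel, size_mkWord, size_mkWord, length_mul]; omega
    · rw [rightMul_push h, size_mkWord, size_mkWord, length_mul]

/-- Each step adds at most the length of its factor, so a single cancellation makes the final bound
strict. -/
theorem prodInvol_mkWord_cases {L : List (FreeMagma X)} (hL : ∀ f ∈ L, f ∈ W X)
    {v : FreeMagma X} (hv : v ∈ W X) :
    (∃ z, ∃ hz : z ∈ W X, fac z = L ++ fac v ∧ (prodInvol L).1 (mkWord v hv) = mkWord z hz) ∨
      size ((prodInvol L).1 (mkWord v hv)) < (L.map FreeMagma.length).sum + v.length := by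
  induction L with
  | nil => exact Or.inl ⟨v, hv, rfl, rfl⟩
  | cons f L ih =>
    have hf := hL f List.mem_cons_self
    have hpos := f.length_pos
    rw [prodInvol_fst_cons, List.map_cons, List.sum_cons]
    rcases ih fun u hu => hL u (List.mem_cons_of_mem _ hu) with ⟨z, hz, h1, h2⟩ | h
    · have hlen : z.length = (L.map FreeMagma.length).sum + v.length := by
        rw [length_eq_sum_fac z, length_eq_sum_fac v, h1, List.map_append, List.sum_append]
      rw [h2]
      rcases mul_mem_W_cases hz hf with rfl | ⟨a, rfl⟩ | h
      · right; rw [rightMul_self, size_nilWord]; omega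
      · right
        rw [rightMul_cancel, size_mkWord]
        rw [length_mul] at hlen
        omega
      · exact Or.inl ⟨z * f, h, by rw [fac_mul, h1]; rfl, rightMul_push h⟩
    · have := size_rightMul_le hf ((prodInvol L).1 (mkWord v hv))
      right
      omega

theorem inv_path_nilWord_cases {y : FreeMagma X} (hy : y ∈ W X) :
    (∃ h : t y ∈ W X, (path y)⁻¹.1 nilWord = mkWord (t y) h) ∨
      ∃ z, ∃ h : z ∈ W X, z.length < y.length ∧ (path y)⁻¹.1 nilWord = mkWord z h := by
  induction y with
  | ih1 x =>
    left
    exact ⟨hy, by rw [path_of, invol_inv]; exact rightMul_nilWord hy⟩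
  | ih2 u v _ _ =>
    obtain ⟨hu, hv, -, -⟩ := (mem_W_mul u v).1 hy
    have h0 : (path (u * v))⁻¹.1 nilWord = (prodInvol (fac u).reverse).1 (mkWord v hv) := by
      rw [path_mul, mul_inv_rev, invol_inv, prodInvol_reverse, ← rightMul_nilWord hv]
      rfl
    rcases prodInvol_mkWord_cases (L := (fac u).reverse)
      (fun f hf => mem_W_of_fac hu f (List.mem_reverse.1 hf)) hv with ⟨z, hz, h1, h2⟩ | h
    · left
      obtain rfl : z = t (u * v) := fac_injective (by rw [h1, fac_t_mul])
      exact ⟨hz, by rw [h0, h2]⟩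
    · right
      rw [← h0, List.map_reverse, List.sum_reverse, ← length_eq_sum_fac, ← length_mul] at h
      rcases ((path (u * v))⁻¹.1 nilWord).cases with h1 | ⟨z, hz, h1⟩
      -- The result is nonempty, since `path y` sends 1 to `y` and not to 1.
      · have h2 := (inv_fst_eq_iff _ _ _).1 h1
        rw [path_nilWord hy] at h2
        exact absurd h2.symm mkWord_ne_nilWord
      · rw [h1, size_mkWord] at h
        exact ⟨z, hz, h, h1⟩

/-- An even palindrome would have two equal neighbours in the middle. -/
theorem exists_eq_of_palindrome {α : Type*} {L : List α} (h : L.Palindrome)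
    (hne : L ≠ []) (hch : L.IsChain (· ≠ ·)) : ∃ A c, L = A ++ c :: A.reverse := by
  induction h with
  | nil => exact absurd rfl hne
  | singleton c => exact ⟨[], c, rfl⟩
  | cons_concat x hl ih =>
    rename_i l
    by_cases hnil : l = []
    · subst hnil
      exact absurd rfl (List.isChain_cons_cons.1 hch).1
    · have hch' : l.IsChain (· ≠ ·) := by
        have : (l ++ [x]).IsChain (· ≠ ·) := hch.tail
        exact this.left_of_append
      obtain ⟨A, c, rfl⟩ := ih hnil hch'
      exact ⟨x :: A, c, by simp⟩

variable [LinearOrder X]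

/-- The words obtained from the empty word by a reflection. -/
def IsReflected (y : FreeMagma X) : Prop :=
  ∃ A c, (∀ v ∈ A, v ∈ R X) ∧ c ∈ R X ∧ ((reflection A c).1 nilWord).1 = (y : Word X)

theorem isReflected_of_mem_R {c : FreeMagma X} (h : c ∈ R X) : IsReflected c := by
  refine ⟨[], c, by simp, h, ?_⟩
  have : reflection [] c = invol c := by simp [reflection]
  rw [this]
  exact congrArg Subtype.val (rightMul_nilWord (mem_W_of_mem_R h))

/-- A reflection r with r·1 = `z` also has r·`z` = 1, so its conjugate by `path y` sends 1 to `path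
y`·1 = `y`. -/
theorem IsReflected.of_inv_path {y z : FreeMagma X} (hy : y ∈ W X) (hf : ∀ f ∈ fac y, f ∈ R X)
    (hz : z ∈ W X) (h : (path y)⁻¹.1 nilWord = mkWord z hz) (hr : IsReflected z) :
    IsReflected y := by
  obtain ⟨A, c, hA, hc, e⟩ := hr
  refine ⟨fac y ++ A, c, ?_, hc, ?_⟩
  · intro v hv
    rcases List.mem_append.1 hv with hv | hv
    exacts [hf v hv, hA v hv]
  · have e1 : (reflection A c).1 nilWord = (path y)⁻¹.1 nilWord := h ▸ Subtype.ext e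
    have e2 : reflection (fac y ++ A) c = path y * reflection A c * (path y)⁻¹ := by
      rw [reflection, reflection, prodInvol_append, path]
      group
    have e3 : (reflection (fac y ++ A) c).1 nilWord = mkWord y hy := by
      rw [e2]
      change (path y).1 ((reflection A c).1 ((path y)⁻¹.1 nilWord)) = _
      rw [← e1]
      change (path y).1 ((reflection A c * reflection A c).1 nilWord) = _
      rw [reflection_mul_self]
      exact path_nilWord hy
    rw [e3]
    rfl

/-- The product is `path b` up to an element fixing 1, so `z = b`; this keeps the descent among
words with factors in `R`. -/
theorem mem_R_of_fac_mkWord {L : List (FreeMagma X)} (hL : ∀ v ∈ L, v ∈ R X) {z : FreeMagma X}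
    {hz : z ∈ W X} (h : (prodInvol L).1 nilWord = mkWord z hz) : ∀ f ∈ fac z, f ∈ R X := by
  obtain ⟨k, hk, e | ⟨b, hb, hbf, e⟩⟩ := exists_eq_path_mul hL
  · rw [e, loopGroup_nilWord hk] at h
    exact absurd h.symm mkWord_ne_nilWord
  · rw [e] at h
    change (path b).1 (k.1 nilWord) = _ at h
    rw [loopGroup_nilWord hk, path_nilWord hb] at h
    rwa [← mkWord_inj.1 h]

theorem isReflected_of_t_eq {y : FreeMagma X} (hy : y ∈ W X) (hf : ∀ f ∈ fac y, f ∈ R X)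
    (h : t y = y) : IsReflected y := by
  have htop : ∃ x, top y = FreeMagma.of x := by rw [← h]; exact top_t y
  have h1 : (fac y).reverse = fac y := by rw [← fac_t htop, h]
  obtain ⟨A, c, e⟩ := exists_eq_of_palindrome (List.Palindrome.of_reverse_eq h1) (fac_ne_nil y)
    (isChain_fac hy)
  rw [e] at hf
  refine ⟨A, c, fun v hv => hf v (by simp [hv]), hf c (by simp), ?_⟩
  rw [reflection_eq_prodInvol, ← e]
  exact congrArg Subtype.val (path_nilWord hy)

theorem isReflected_of_mem_fac {y : FreeMagma X} (hy : y ∈ W X) (hf : ∀ f ∈ fac y, f ∈ R X) :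
    IsReflected y := by
  induction hn : y.length using Nat.strong_induction_on generalizing y with
  | _ n ih =>
  subst hn
  have hfac : ∀ {y z : FreeMagma X} (hz : z ∈ W X), (∀ f ∈ fac y, f ∈ R X) →
      (path y)⁻¹.1 nilWord = mkWord z hz → ∀ f ∈ fac z, f ∈ R X := by
    intro y z hz hf h
    rw [path, ← prodInvol_reverse] at h
    exact mem_R_of_fac_mkWord (fun v hv => hf v (List.mem_reverse.1 hv)) h
  have hlen : (t y).length = y.length := by
    induction y with
    | ih1 x => rfl
    | ih2 u v _ _ =>
      rw [length_eq_sum_fac, fac_t_mul, List.map_append, List.sum_append, List.map_reverse,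
        List.sum_reverse, ← length_eq_sum_fac, ← length_eq_sum_fac, length_mul]
  rcases inv_path_nilWord_cases hy with ⟨h1, e1⟩ | ⟨z, hz, hlt, e⟩
  swap
  · exact (ih z.length hlt hz (hfac hz hf e) rfl).of_inv_path hy hf hz e
  have hf1 := hfac h1 hf e1
  refine IsReflected.of_inv_path hy hf h1 e1 ?_
  rcases inv_path_nilWord_cases h1 with ⟨h2, e2⟩ | ⟨z, hz, hlt, e⟩
  swap
  · exact (ih z.length (hlen ▸ hlt) hz (hfac hz hf1 e) rfl).of_inv_path h1 hf1 hz e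
  have hf2 := hfac h2 hf1 e2
  -- Neither inverse path shortens the word now, so `t y` and `t (t y)` are both reduced.
  by_cases hpal : t (t y) = t y
  · exact isReflected_of_t_eq h1 hf1 hpal
  rcases minT_eq y with hm | hm
  · refine isReflected_of_mem_R (mem_R_of_mem_D ⟨y, hy, hm.symm, ?_⟩ hf1)
    rw [hm]
    exact ⟨h1, h2, hpal⟩
  · refine IsReflected.of_inv_path h1 hf1 h2 e2 ?_
    refine isReflected_of_mem_R (mem_R_of_mem_D ⟨y, hy, hm.symm, ?_⟩ hf2)
    rw [hm, t_t (top_t y)]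
    exact ⟨h2, h1, fun h => hpal h.symm⟩

end FreeBol

/-! ### The theorem. -/

theorem theorem4p1 {X : Type*} [LinearOrder X] [Finite X]
    (g : FreeBol.Word X) (hg : g ∈ FreeBol.B X) (hg1 : g ≠ 1) :
    ∃! l : List (FreeMagma X),
      l ≠ [] ∧ (∀ u ∈ l, u ∈ FreeBol.R X) ∧ l.IsChain (· ≠ ·) ∧
        g = FreeBol.red (FreeBol.symProd l) := by
  obtain ⟨y, rfl⟩ := WithOne.ne_one_iff_exists.1 hg1
  obtain ⟨hy, hf⟩ := FreeBol.mem_R_of_mem_B hg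
  have hW : ∀ {A : List (FreeMagma X)}, (∀ u ∈ A, u ∈ FreeBol.R X) → ∀ u ∈ A, u ∈ FreeBol.W X :=
    fun h u hu => FreeBol.mem_W_of_mem_R (h u hu)
  obtain ⟨A₀, c₀, hA₀, hc₀, e₀⟩ := FreeBol.isReflected_of_mem_fac hy hf
  obtain ⟨A, c, hA, hc, hch, e⟩ := FreeBol.exists_reflection_isChain _ A₀ c₀ hA₀ hc₀
  rw [← e] at e₀
  refine ⟨A ++ [c], ⟨by simp, ?_, hch, ?_⟩, ?_⟩
  · intro u hu
    rcases List.mem_append.1 hu with hu | hu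
    · exact hA u hu
    · rwa [List.mem_singleton.1 hu]
  · rw [← FreeBol.reflection_nilWord_val (hW hA) (FreeBol.mem_W_of_mem_R hc), e₀]
  · rintro l ⟨hne, hl, hch', h⟩
    obtain ⟨A', c', rfl⟩ := (List.eq_nil_or_concat l).resolve_left hne
    have hA' : ∀ u ∈ A', u ∈ FreeBol.R X := fun u hu => hl u (by simp [hu])
    have hc' : c' ∈ FreeBol.R X := hl c' (by simp)
    rw [List.concat_eq_append] at hch' h ⊢
    rw [← FreeBol.reflection_nilWord_val (hW hA') (FreeBol.mem_W_of_mem_R hc'), ← e₀] at h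
    exact FreeBol.eq_of_reflection_eq hch' hch
      (FreeBol.reflection_eq_of_apply_nilWord_eq hA' hc' hA hc (Subtype.ext h.symm))
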